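/- Let $d\ge 1$ be an integer and $1\le p<\infty$. For $\kappa\ge 0$ and $R>0$, call $\Omega$ a $(\kappa,R)$-Lipschitz domain if it is a bounded open subset of $\mathbb{R}^d$ such that for every $\xi\in\partial\Omega$ there are a Cartesian coordinate system $(x',x_d)\in\mathbb{R}^{d-1}\times\mathbb{R}$ and a function $\zeta:\mathbb{R}^{d-1}\to\mathbb{R}$ with $|\zeta(x')-\zeta(y')|\le\kappa|x'-y'|$, such that in the ball $B(\xi,R)$ the set $\Omega$ coincides with $\{x_d>\zeta(x')\}$ and $\partial\Omega$ coincides with $\{x_d=\zeta(x')\}$. For $\tau>0$ let $\Omega_\tau=\{x\in\Omega:\operatorname{dist}(x,\partial\Omega)>\tau\}$, and write $B_r$ for the ball of radius $r$ about $0$. For $u:\Omega\to\mathbb{R}^d$ and $\rho\ge 0$ let $$|u|^p_{\mathcal{S}_{\rho,p}(\Omega)}=\int_\Omega\int_\Omega\rho(y-x)\left|\frac{u(y)-u(x)}{|y-x|}\cdot\frac{y-x}{|y-x|}\right|^p\,dy\,dx\in[0,\infty].$$ For all $d$, $p$, $\kappa$ there are constants $C_2>0$ and $\epsilon_0\in(0,1)$,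 depending only on $d$, $p$, $\kappa$, and for every $R>0$ there is a constant $r_0>0$, depending only on $d$, $p$, $\kappa$, $R$, with the following property. For every $(\kappa,R)$-Lipschitz domain $\Omega$ there is a function $C_1:(0,r_0)\to(0,\infty)$ such that for every $r\in(0,r_0)$, every $u\in L^p(\Omega;\mathbb{R}^d)$ and every nonnegative radial $\rho\in L^1_{loc}(\mathbb{R}^d)$ with $\int_{B_r}\rho(h)\,dh>0$, $$\int_\Omega|u|^p\,dx\le C_1(r)\int_{\Omega_{\epsilon_0 r}}|u|^p\,dx+\frac{C_2\,r^p}{\int_{B_r}\rho(h)\,dh}\,|u|^p_{\mathcal{S}_{\rho,p}(\Omega)}.$$ -/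

import Mathlib

open MeasureTheory Metric
open scoped NNReal ENNReal

noncomputable section

/-- Near the point `ξ`, at scale `R`, the set `Ω` is the region strictly above the graph of a
`κ`-Lipschitz function and its boundary is that graph. The coordinate system is given by the unit
vector `e`: a point `x` has the coordinates `x' = x - ⟪e, x⟫ e`, in the hyperplane orthogonal to
`e`, and `x_d = ⟪e, x⟫`. Only the values of `ζ` on that hyperplane matter. -/
def IsLipschitzGraphAt {d : ℕ} (κ : ℝ≥0) (R : ℝ) (Ω : Set (EuclideanSpace ℝ (Fin d)))
    (ξ : EuclideanSpace ℝ (Fin d)) : Prop :=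
  ∃ (e : EuclideanSpace ℝ (Fin d)) (ζ : EuclideanSpace ℝ (Fin d) → ℝ),
    ‖e‖ = 1 ∧
    LipschitzOnWith κ ζ {x' | inner ℝ e x' = 0} ∧
    Ω ∩ ball ξ R = {x | ζ (x - inner ℝ e x • e) < inner ℝ e x} ∩ ball ξ R ∧
    frontier Ω ∩ ball ξ R = {x | inner ℝ e x = ζ (x - inner ℝ e x • e)} ∩ ball ξ R

/-- `Ω` is a bounded open set with Lipschitz boundary, with Lipschitz constant `κ` of the local
graphs and localization radius `R`, both uniform along the boundary. -/
structure IsLipschitzDomain {d : ℕ} (κ : ℝ≥0) (R : ℝ)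
    (Ω : Set (EuclideanSpace ℝ (Fin d))) : Prop where
  isOpen : IsOpen Ω
  isBounded : Bornology.IsBounded Ω
  graph : ∀ ξ ∈ frontier Ω, IsLipschitzGraphAt κ R Ω ξ

/-- `Ω_τ`: the points of `Ω` at distance greater than `τ` from the boundary. -/
def innerPart {d : ℕ} (Ω : Set (EuclideanSpace ℝ (Fin d))) (τ : ℝ) :
    Set (EuclideanSpace ℝ (Fin d)) :=
  {x | x ∈ Ω ∧ τ < infDist x (frontier Ω)}

/-- The projected difference quotient `𝒟(u)(x, y)`. -/
def projDiffQuot {d : ℕ} (u : EuclideanSpace ℝ (Fin d) → EuclideanSpace ℝ (Fin d))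
    (x y : EuclideanSpace ℝ (Fin d)) : ℝ :=
  inner ℝ (‖y - x‖⁻¹ • (u y - u x)) (‖y - x‖⁻¹ • (y - x))

/-- The `p`-th power of the seminorm of `𝒮_{ρ,p}(Ω)`, with values in `[0, ∞]`. -/
def nonlocalSeminormPow {d : ℕ} (ρ : EuclideanSpace ℝ (Fin d) → ℝ) (p : ℝ)
    (Ω : Set (EuclideanSpace ℝ (Fin d)))
    (u : EuclideanSpace ℝ (Fin d) → EuclideanSpace ℝ (Fin d)) : ℝ≥0∞ :=
  ∫⁻ x in Ω, ∫⁻ y in Ω, ENNReal.ofReal (ρ (y - x) * |projDiffQuot u x y| ^ p)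

end

/-! Only points within `ε * r` of the boundary need work. From such a point `x`, a cone of
directions points into the domain: moving along it keeps `x` in Ω up to length `2 * r` and puts it
in the inner part from length `r` on (`IsLipschitzDomain.exists_mem_conePart`). Finitely many cone
axes serve all boundary points.

For a step `h` in the cone with `‖h‖ < r`, telescoping along `x, x + h, …, x + N • h` bounds the
component of `u x` along `h` by `u` at a deep point plus `N` projected difference quotients. As `N *
‖h‖ ≤ 2 * r`, integrating in `x` costs only a factor `r ^ p`, uniformly in `h`
(`setLIntegral_conePart_le`).

Weighting by ρ and integrating over `h` in the cone recovers all of `‖u x‖`, because the components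
along an open set of directions determine a vector (`exists_norm_rpow_mul_setLIntegral_le`);
radiality makes the cone carry a fixed fraction of the mass of ρ. Dividing by that mass and summing
over the axes gives the estimate. -/

/-! ### Cones of directions -/

section Sector

variable {E : Type*} [NormedAddCommGroup E] [InnerProductSpace ℝ E]

/-- The closed cone of vectors whose direction is within `η` of `w`. -/
def sector (w : E) (η : ℝ) : Set E := {h | ‖h - ‖h‖ • w‖ ≤ η * ‖h‖}

theorem isClosed_sector (w : E) (η : ℝ) : IsClosed (sector w η) :=
  isClosed_le (by fun_prop) (by fun_prop)

theorem sector_subset_sector {w w' : E} {η η' : ℝ} (h : η' + ‖w' - w‖ ≤ η) :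
    sector w' η' ⊆ sector w η := by
  intro x hx
  simp only [sector, Set.mem_ofPred_eq] at hx ⊢
  have h1 : x - ‖x‖ • w = (x - ‖x‖ • w') + ‖x‖ • (w' - w) := by rw [smul_sub]; abel
  have h2 : ‖‖x‖ • (w' - w)‖ = ‖x‖ * ‖w' - w‖ := by rw [norm_smul, norm_norm]
  calc ‖x - ‖x‖ • w‖ ≤ ‖x - ‖x‖ • w'‖ + ‖‖x‖ • (w' - w)‖ := by rw [h1]; exact norm_add_le _ _
    _ ≤ η' * ‖x‖ + ‖x‖ * ‖w' - w‖ := by rw [h2]; gcongr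
    _ = (η' + ‖w' - w‖) * ‖x‖ := by ring
    _ ≤ η * ‖x‖ := by gcongr

theorem nsmul_mem_sector {w h : E} {η : ℝ} (hh : h ∈ sector w η) (n : ℕ) :
    n • h ∈ sector w η := by
  simp only [sector, Set.mem_ofPred_eq, ← Nat.cast_smul_eq_nsmul ℝ, norm_smul,
    RCLike.norm_natCast] at hh ⊢
  rw [mul_smul, ← smul_sub, norm_smul, RCLike.norm_natCast, mul_left_comm]
  gcongr

theorem exists_finset_net_sphere [FiniteDimensional ℝ E] {η : ℝ} (hη : 0 < η) :
    ∃ t : Finset E, (∀ w ∈ t, ‖w‖ = 1) ∧ ∀ e : E, ‖e‖ = 1 → ∃ w ∈ t, ‖e - w‖ ≤ η := by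
  obtain ⟨t, ht, hfin, hcov⟩ := (isCompact_sphere (0 : E) 1).finite_cover_balls hη
  refine ⟨hfin.toFinset, fun w hw => by simpa using ht (hfin.mem_toFinset.1 hw), fun e he => ?_⟩
  obtain ⟨w, hw, hew⟩ := Set.mem_iUnion₂.1 (hcov (show e ∈ sphere (0 : E) 1 by simpa using he))
  exact ⟨w, hfin.mem_toFinset.2 hw, by simpa [dist_eq_norm] using (mem_ball.1 hew).le⟩

/-- Any cone contains a smaller one on which a given linear functional is bounded below. -/
theorem exists_subsector_le_abs_inner {w : E} (hw : ‖w‖ = 1) {δ : ℝ} (hδ : 0 < δ) (hδ1 : δ ≤ 1)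
    (a : E) :
    ∃ w' : E, ‖w'‖ = 1 ∧ sector w' (δ / 16) ⊆ sector w δ ∧
      ∀ h ∈ sector w' (δ / 16), δ / 16 * ‖a‖ * ‖h‖ ≤ |inner ℝ a h| := by
  rcases eq_or_ne a 0 with rfl | ha
  · exact ⟨w, hw, sector_subset_sector (by simp; linarith), by simp⟩
  have hapos : 0 < ‖a‖ := norm_pos_iff.2 ha
  -- Tilt `w` by `δ / 4` towards `a` or `-a`, with the sign that avoids cancellation against `inner
  -- ℝ a w`.
  obtain ⟨s, hs, hsa⟩ : ∃ s : ℝ, |s| = 1 ∧ δ / 4 * ‖a‖ ≤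
      |inner ℝ a (w + (s * (δ / 4) / ‖a‖) • a)| := by
    have hin (s : ℝ) : inner ℝ a (w + (s * (δ / 4) / ‖a‖) • a)
        = inner ℝ a w + s * (δ / 4 * ‖a‖) := by
      rw [inner_add_right, inner_smul_right, real_inner_self_eq_norm_sq]
      field_simp
    simp only [hin]
    rcases le_total 0 (inner ℝ a w) with h | h
    · exact ⟨1, by simp, le_trans (by linarith) (le_abs_self _)⟩
    · exact ⟨-1, by simp, le_trans (by linarith) (neg_le_abs _)⟩
  set v := w + (s * (δ / 4) / ‖a‖) • a with hv
  have hvw : ‖v - w‖ = δ / 4 := by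
    rw [hv, add_sub_cancel_left, norm_smul, Real.norm_eq_abs, abs_div, abs_mul, hs, abs_norm,
      abs_of_pos (by positivity : 0 < δ / 4)]
    field_simp
  have hv1 : |‖v‖ - 1| ≤ δ / 4 := by
    rw [← hw, ← hvw]; exact abs_norm_sub_norm_le _ _
  obtain ⟨hv2, hv3⟩ := abs_le.1 hv1
  have hvpos : 0 < ‖v‖ := by linarith
  have hvv : ‖‖v‖⁻¹ • v - v‖ = |‖v‖ - 1| := by
    have : ‖v‖⁻¹ • v - v = (‖v‖⁻¹ - 1) • v := by rw [sub_smul, one_smul]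
    rw [this, norm_smul, Real.norm_eq_abs]
    nth_rewrite 2 [← abs_of_pos hvpos]
    rw [← abs_mul, abs_sub_comm ‖v‖]
    congr 1
    field_simp
  have hw1 : ‖‖v‖⁻¹ • v‖ = 1 := by
    rw [norm_smul, norm_inv, norm_norm]; field_simp
  refine ⟨‖v‖⁻¹ • v, hw1, sector_subset_sector ?_, fun h hh => ?_⟩
  · have := norm_sub_le_norm_sub_add_norm_sub (‖v‖⁻¹ • v) v w
    linarith
  · have h1 : inner ℝ a h = ‖h‖ * inner ℝ a (‖v‖⁻¹ • v) + inner ℝ a (h - ‖h‖ • ‖v‖⁻¹ • v) := by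
      rw [inner_sub_right, inner_smul_right _ _ ‖h‖]; ring
    have h2 : |inner ℝ a (h - ‖h‖ • ‖v‖⁻¹ • v)| ≤ ‖a‖ * (δ / 16 * ‖h‖) :=
      (abs_real_inner_le_norm _ _).trans (by gcongr; exact hh)
    have h3 : δ / 8 * ‖a‖ ≤ |inner ℝ a (‖v‖⁻¹ • v)| := by
      rw [inner_smul_right, abs_mul, abs_of_pos (inv_pos.2 hvpos), inv_mul_eq_div,
        le_div_iff₀ hvpos]
      nlinarith [mul_pos hδ hapos]
    have h4 : ‖h‖ * |inner ℝ a (‖v‖⁻¹ • v)| ≤ |inner ℝ a h| +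
        |inner ℝ a (h - ‖h‖ • ‖v‖⁻¹ • v)| := by
      have : ‖h‖ * inner ℝ a (‖v‖⁻¹ • v) =
        inner ℝ a h - inner ℝ a (h - ‖h‖ • ‖v‖⁻¹ • v) := by linarith
      rw [← abs_of_nonneg (norm_nonneg h), ← abs_mul, this, abs_of_nonneg (norm_nonneg h)]
      exact abs_sub _ _
    nlinarith [mul_le_mul_of_nonneg_left h3 (norm_nonneg h)]

end Sector

/-! ### Radial weights on cones -/

section RadialIntegral

variable {E : Type*} [NormedAddCommGroup E] [InnerProductSpace ℝ E] [FiniteDimensional ℝ E]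
  [MeasurableSpace E] [BorelSpace E]

/-- The reflection exchanging the two axes preserves volume and norms. -/
theorem setLIntegral_sector_eq {w w' : E} (hw : ‖w‖ = 1) (hw' : ‖w'‖ = 1) (η r : ℝ)
    {G : E → ℝ≥0∞} (hG : ∀ h k, ‖h‖ = ‖k‖ → G h = G k) :
    ∫⁻ h in sector w η ∩ ball 0 r, G h = ∫⁻ h in sector w' η ∩ ball 0 r, G h := by
  set T : E ≃ₗᵢ[ℝ] E := (ℝ ∙ (w - w'))ᗮ.reflection
  have hTw : T w = w' := Submodule.reflection_sub (hw.trans hw'.symm)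
  have hpre : T ⁻¹' (sector w' η ∩ ball 0 r) = sector w η ∩ ball 0 r := by
    ext h
    have : T h - ‖h‖ • w' = T (h - ‖h‖ • w) := by rw [map_sub, map_smul, hTw]
    simp only [sector, Set.mem_preimage, Set.mem_inter_iff, Set.mem_ofPred_eq, T.norm_map, this,
      mem_ball_zero_iff]
  rw [← hpre, ← T.measurePreserving.setLIntegral_comp_preimage_emb
    T.toHomeomorph.measurableEmbedding G (sector w' η ∩ ball 0 r)]
  exact lintegral_congr fun h => hG _ _ (T.norm_map h).symm

/-- A finite net of axes gives cones covering the ball, all with the same integral; `M` is the size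
of the net. -/
theorem exists_setLIntegral_ball_le_sector {η : ℝ} (hη : 0 < η) :
    ∃ M : ℕ, ∀ w : E, ‖w‖ = 1 → ∀ (r : ℝ) (G : E → ℝ≥0∞), (∀ h k, ‖h‖ = ‖k‖ → G h = G k) →
      ∫⁻ h in ball 0 r, G h ≤ M * ∫⁻ h in sector w η ∩ ball 0 r, G h := by
  obtain ⟨t, ht, hnet⟩ := exists_finset_net_sphere (E := E) hη
  refine ⟨t.card, fun w hw r G hG => ?_⟩
  have hcov : ball (0 : E) r ⊆ ⋃ v : t, sector (v : E) η ∩ ball 0 r := by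
    intro h hh
    obtain ⟨e, he, heh⟩ : ∃ e : E, ‖e‖ = 1 ∧ h = ‖h‖ • e := by
      rcases eq_or_ne h 0 with rfl | h0
      · exact ⟨w, hw, by simp⟩
      · have := norm_ne_zero_iff.2 h0
        exact ⟨‖h‖⁻¹ • h, by rw [norm_smul, norm_inv, norm_norm]; field_simp,
          by rw [smul_smul, mul_inv_cancel₀ this, one_smul]⟩
    obtain ⟨v, hv, hev⟩ := hnet e he
    refine Set.mem_iUnion.2 ⟨⟨v, hv⟩, ?_, hh⟩
    change ‖h - ‖h‖ • v‖ ≤ η * ‖h‖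
    nth_rewrite 1 [heh]
    rw [← smul_sub, norm_smul, norm_norm, mul_comm]
    gcongr
  calc ∫⁻ h in ball 0 r, G h ≤ ∫⁻ h in ⋃ v : t, sector (v : E) η ∩ ball 0 r, G h :=
        lintegral_mono_set hcov
    _ ≤ ∑' v : t, ∫⁻ h in sector (v : E) η ∩ ball 0 r, G h := lintegral_iUnion_le _ _
    _ = ∑ v : t, ∫⁻ h in sector w η ∩ ball 0 r, G h := by
        rw [tsum_fintype]
        exact Finset.sum_congr rfl fun v _ => setLIntegral_sector_eq (ht v v.2) hw η r hG
    _ = t.card * ∫⁻ h in sector w η ∩ ball 0 r, G h := by simp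

/-- The mean over a cone of the directional components of `a` controls `‖a‖`, with a radial
weight. -/
theorem exists_norm_rpow_mul_setLIntegral_le [Nontrivial E] {p : ℝ} (hp : 0 ≤ p)
    {δ : ℝ} (hδ : 0 < δ) (hδ1 : δ ≤ 1) :
    ∃ C : ℝ, 0 < C ∧ ∀ w : E, ‖w‖ = 1 → ∀ (r : ℝ) (G : E → ℝ≥0∞),
      (∀ h k, ‖h‖ = ‖k‖ → G h = G k) → ∀ a : E,
      ENNReal.ofReal (‖a‖ ^ p) * ∫⁻ h in ball 0 r, G h ≤ ENNReal.ofReal C *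
        ∫⁻ h in sector w δ ∩ ball 0 r, G h * ENNReal.ofReal (|inner ℝ a (‖h‖⁻¹ • h)| ^ p) := by
  obtain ⟨M, hM⟩ := exists_setLIntegral_ball_le_sector (E := E) (η := δ / 16) (by positivity)
  refine ⟨(M + 1) * (δ / 16)⁻¹ ^ p, by positivity, fun w hw r G hG a => ?_⟩
  -- The subcone depends on `a`, but its aperture `δ / 16` does not, so neither does the constant.
  obtain ⟨w', hw', hsub, hlow⟩ := exists_subsector_le_abs_inner hw hδ hδ1 a
  have hmeas : MeasurableSet (sector w' (δ / 16) ∩ ball (0 : E) r) :=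
    (isClosed_sector _ _).measurableSet.inter measurableSet_ball
  have hMM : (M : ℝ≥0∞) ≤ ENNReal.ofReal (M + 1) := by
    rw [← ENNReal.ofReal_natCast]; exact ENNReal.ofReal_le_ofReal (by linarith)
  have key : ∀ h ∈ sector w' (δ / 16), h ≠ 0 → ENNReal.ofReal (‖a‖ ^ p) * G h ≤
      ENNReal.ofReal ((δ / 16)⁻¹ ^ p) *
        (G h * ENNReal.ofReal (|inner ℝ a (‖h‖⁻¹ • h)| ^ p)) := by
    intro h hh h0
    have hpos : 0 < ‖h‖ := norm_pos_iff.2 h0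
    rw [mul_left_comm, mul_comm (G h), ← ENNReal.ofReal_mul (by positivity), mul_comm _ (G h),
      mul_comm _ (G h), ← Real.mul_rpow (by positivity) (by positivity)]
    gcongr
    rw [inner_smul_right, abs_mul, abs_of_pos (inv_pos.2 hpos), inv_mul_eq_div, inv_mul_eq_div,
      le_div_iff₀ (by positivity), le_div_iff₀ hpos]
    have := hlow h hh
    linarith
  calc ENNReal.ofReal (‖a‖ ^ p) * ∫⁻ h in ball 0 r, G h
      ≤ ENNReal.ofReal (‖a‖ ^ p) * (M * ∫⁻ h in sector w' (δ / 16) ∩ ball 0 r, G h) := by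
        gcongr; exact hM w' hw' r G hG
    _ = M * ∫⁻ h in sector w' (δ / 16) ∩ ball 0 r, ENNReal.ofReal (‖a‖ ^ p) * G h := by
        rw [lintegral_const_mul' _ _ ENNReal.ofReal_ne_top]; ring
    _ ≤ M * ∫⁻ h in sector w' (δ / 16) ∩ ball 0 r, ENNReal.ofReal ((δ / 16)⁻¹ ^ p) *
        (G h * ENNReal.ofReal (|inner ℝ a (‖h‖⁻¹ • h)| ^ p)) := by
        gcongr 1
        refine lintegral_mono_ae ?_
        filter_upwards [ae_restrict_mem hmeas, ae_restrict_of_ae (volume.ae_ne (0 : E))]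
          with h hh h0 using key h hh.1 h0
    _ ≤ _ := by
        rw [lintegral_const_mul' _ _ ENNReal.ofReal_ne_top, ← mul_assoc,
          ENNReal.ofReal_mul (by positivity)]
        gcongr

end RadialIntegral

/-! ### Height over a Lipschitz graph -/

section Geometry

variable {E : Type*} [NormedAddCommGroup E] [InnerProductSpace ℝ E]

theorem norm_sub_inner_smul_le {e : E} (he : ‖e‖ = 1) (v : E) :
    ‖v - inner ℝ e v • e‖ ≤ ‖v‖ := by
  have h : ‖v - inner ℝ e v • e‖ ^ 2 = ‖v‖ ^ 2 - (inner ℝ e v) ^ 2 := by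
    rw [norm_sub_sq_real, inner_smul_right, norm_smul, he, Real.norm_eq_abs, mul_one, sq_abs,
      real_inner_comm]
    ring
  exact le_of_sq_le_sq (by nlinarith [sq_nonneg (inner ℝ e v)]) (norm_nonneg _)

theorem inner_sub_inner_smul_self {e : E} (he : ‖e‖ = 1) (v : E) :
    inner ℝ e (v - inner ℝ e v • e) = 0 := by
  rw [inner_sub_right, inner_smul_right, real_inner_self_eq_norm_sq, he]; ring

theorem abs_sub_graph_le {κ : ℝ≥0} {e : E} {ζ : E → ℝ} (he : ‖e‖ = 1)
    (hζ : LipschitzOnWith κ ζ {x' | inner ℝ e x' = 0}) (x s : E) :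
    |ζ (x + s - inner ℝ e (x + s) • e) - ζ (x - inner ℝ e x • e)|
      ≤ κ * ‖s - inner ℝ e s • e‖ := by
  have h := hζ.dist_le_mul (x + s - inner ℝ e (x + s) • e) (inner_sub_inner_smul_self he _)
    (x - inner ℝ e x • e) (inner_sub_inner_smul_self he _)
  rw [Real.dist_eq, dist_eq_norm] at h
  have hdiff : x + s - inner ℝ e (x + s) • e - (x - inner ℝ e x • e) = s - inner ℝ e s • e := by
    rw [inner_add_right, add_smul]; abel
  rwa [hdiff] at h

/-- Turns height over the graph into a lower bound for the distance to the boundary. -/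
theorem graph_height_le {κ : ℝ≥0} {e : E} {ζ : E → ℝ} (he : ‖e‖ = 1)
    (hζ : LipschitzOnWith κ ζ {x' | inner ℝ e x' = 0}) {y z : E}
    (hz : inner ℝ e z = ζ (z - inner ℝ e z • e)) :
    inner ℝ e y - ζ (y - inner ℝ e y • e) ≤ (1 + κ) * dist y z := by
  have h := abs_sub_graph_le he hζ z (y - z)
  rw [add_sub_cancel] at h
  have h1 : inner ℝ e (y - z) ≤ ‖y - z‖ := by
    simpa [he] using real_inner_le_norm e (y - z)
  rw [inner_sub_right] at h1
  have h2 := mul_le_mul_of_nonneg_left (norm_sub_inner_smul_le he (y - z)) κ.coe_nonneg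
  rw [dist_eq_norm]
  linarith [neg_abs_le (ζ (y - inner ℝ e y • e) - ζ (z - inner ℝ e z • e))]

/-- Moving inside a narrow cone about the vertical direction increases the height over the
graph. -/
theorem graph_height_add_sector {κ : ℝ≥0} {e w : E} {ζ : E → ℝ} (he : ‖e‖ = 1)
    (hζ : LipschitzOnWith κ ζ {x' | inner ℝ e x' = 0})
    (hew : ‖e - w‖ ≤ 1 / (4 * (1 + κ))) {s : E} (hs : s ∈ sector w (1 / (4 * (1 + κ)))) (x : E) :
    inner ℝ e x - ζ (x - inner ℝ e x • e) + ‖s‖ / 2 ≤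
      inner ℝ e (x + s) - ζ (x + s - inner ℝ e (x + s) • e) := by
  have hκ : 0 ≤ (κ : ℝ) := κ.coe_nonneg
  -- The aperture and the tilt of `w` add up to `1 / (2 * (1 + κ))`, so the deviation from `e` costs
  -- at most half of the climb `‖s‖`.
  have hs' : ‖s - ‖s‖ • e‖ ≤ 1 / (2 * (1 + κ)) * ‖s‖ := by
    refine sector_subset_sector (w := e) (η := 1 / (2 * (1 + κ))) ?_ hs
    rw [norm_sub_rev]
    have : 1 / (2 * (1 + (κ : ℝ))) = 1 / (4 * (1 + κ)) + 1 / (4 * (1 + κ)) := by field_simp; norm_num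
    linarith
  have h1 : inner ℝ e s = ‖s‖ + inner ℝ e (s - ‖s‖ • e) := by
    rw [inner_sub_right, inner_smul_right, real_inner_self_eq_norm_sq, he]; ring
  have h2 : |inner ℝ e (s - ‖s‖ • e)| ≤ ‖s - ‖s‖ • e‖ := by
    simpa [he] using abs_real_inner_le_norm e (s - ‖s‖ • e)
  have h3 : ‖s - inner ℝ e s • e‖ ≤ ‖s - ‖s‖ • e‖ := by
    have := norm_sub_inner_smul_le he (s - ‖s‖ • e)
    have hproj : s - ‖s‖ • e - inner ℝ e (s - ‖s‖ • e) • e = s - inner ℝ e s • e := by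
      rw [h1, add_smul]; abel
    rwa [hproj] at this
  have h4 := abs_sub_graph_le he hζ x s
  have h5 := mul_le_mul_of_nonneg_left h3 hκ
  have h6 : (1 + κ) * ‖s - ‖s‖ • e‖ ≤ ‖s‖ / 2 := by
    calc (1 + κ) * ‖s - ‖s‖ • e‖ ≤ (1 + κ) * (1 / (2 * (1 + κ)) * ‖s‖) := by gcongr
      _ = ‖s‖ / 2 := by field_simp
  rw [inner_add_right] at h4 ⊢
  linarith [le_abs_self (ζ (x + s - (inner ℝ e x + inner ℝ e s) • e) - ζ (x - inner ℝ e x • e)),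
    neg_abs_le (inner ℝ e (s - ‖s‖ • e))]

end Geometry

/-! ### Interior cones of a Lipschitz domain -/

section Domain

variable {d : ℕ}

/-- The points of `Ω` from which the cone about `w` stays inside `Ω` up to length `2 * r` and is
deep inside `Ω` from length `r` on. -/
def conePart (Ω : Set (EuclideanSpace ℝ (Fin d))) (w : EuclideanSpace ℝ (Fin d)) (ε r : ℝ) :
    Set (EuclideanSpace ℝ (Fin d)) :=
  {x | ∀ s ∈ sector w ε, ‖s‖ ≤ 2 * r → x + s ∈ Ω ∧ (r ≤ ‖s‖ → x + s ∈ innerPart Ω (ε * r))}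

/-- Use the chart at the boundary point nearest to `x`. After a move of length at least `r` the
height exceeds `r / 2`, whereas a point within `ε * r` of the boundary has height at most `r / 4`.
The bound `r < R / 8` keeps all points involved in the chart. -/
theorem IsLipschitzDomain.exists_mem_conePart [Nontrivial (EuclideanSpace ℝ (Fin d))] {κ : ℝ≥0}
    {R : ℝ} {Ω : Set (EuclideanSpace ℝ (Fin d))} (hΩ : IsLipschitzDomain κ R Ω) {r : ℝ}
    (hr : 0 < r) (hrR : r < R / 8) {t : Finset (EuclideanSpace ℝ (Fin d))}
    (ht : ∀ e : EuclideanSpace ℝ (Fin d), ‖e‖ = 1 → ∃ w ∈ t, ‖e - w‖ ≤ 1 / (4 * (1 + κ)))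
    {x : EuclideanSpace ℝ (Fin d)} (hx : x ∈ Ω)
    (hxi : x ∉ innerPart Ω (1 / (4 * (1 + κ)) * r)) :
    ∃ w ∈ t, x ∈ conePart Ω w (1 / (4 * (1 + κ))) r := by
  have hκ : 0 ≤ (κ : ℝ) := κ.coe_nonneg
  have hne : (frontier Ω).Nonempty := by
    refine nonempty_frontier_iff.2 ⟨⟨x, hx⟩, fun h => ?_⟩
    exact NormedSpace.unbounded_univ ℝ (EuclideanSpace ℝ (Fin d)) (h ▸ hΩ.isBounded)
  set ε : ℝ := 1 / (4 * (1 + κ)) with hε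
  have hε4 : (1 + κ) * (ε * r) = r / 4 := by rw [hε]; field_simp
  have hε1 : ε * r ≤ r / 4 := by
    rw [← hε4]; nlinarith [show 0 ≤ ε * r by positivity]
  obtain ⟨ξ, hξ, hxξ⟩ := isClosed_frontier.exists_infDist_eq_dist hne x
  have hxξ' : dist x ξ ≤ ε * r := by
    rw [← hxξ]; by_contra h; exact hxi ⟨hx, not_le.1 h⟩
  obtain ⟨e, ζ, he, hζ, hin, hfr⟩ := hΩ.graph ξ hξ
  obtain ⟨w, hw, hew⟩ := ht e he
  refine ⟨w, hw, fun s hs hsr => ?_⟩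
  have hup := graph_height_add_sector he hζ hew hs x
  have hx0 : ζ (x - inner ℝ e x • e) < inner ℝ e x :=
    (hin.subset ⟨hx, mem_ball.2 (by linarith)⟩).1
  have hball : dist (x + s) ξ < R / 2 := by
    have : dist (x + s) ξ ≤ dist (x + s) x + dist x ξ := dist_triangle _ _ _
    rw [dist_self_add_left] at this
    linarith
  have hmem : x + s ∈ Ω := by
    refine (hin.superset ⟨?_, mem_ball.2 (by linarith)⟩).1
    change ζ (x + s - inner ℝ e (x + s) • e) < inner ℝ e (x + s)
    linarith [norm_nonneg s]
  refine ⟨hmem, fun hrs => ⟨hmem, ?_⟩⟩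
  obtain ⟨z, hz, hsz⟩ := isClosed_frontier.exists_infDist_eq_dist hne (x + s)
  rw [hsz]
  by_contra! hlt
  have hzball : z ∈ ball ξ R := by
    have : dist z ξ ≤ dist (x + s) z + dist (x + s) ξ := dist_triangle_left _ _ _
    exact mem_ball.2 (by linarith)
  have hle := graph_height_le he hζ (y := x + s) (hfr.subset ⟨hz, hzball⟩).1
  have := mul_le_mul_of_nonneg_left hlt (by positivity : 0 ≤ 1 + (κ : ℝ))
  linarith

end Domain

/-! ### Telescoping along a step -/

section Telescoping

variable {d : ℕ}

local notation "𝔼" => EuclideanSpace ℝ (Fin d)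

theorem inner_sub_direction_eq (u : 𝔼 → 𝔼) (x : 𝔼) {h : 𝔼} (hh : h ≠ 0) :
    inner ℝ (u (x + h) - u x) (‖h‖⁻¹ • h) = ‖h‖ * projDiffQuot u x (x + h) := by
  have := norm_ne_zero_iff.2 hh
  rw [projDiffQuot, add_sub_cancel_left, inner_smul_left, conj_trivial, mul_inv_cancel_left₀ this]

theorem abs_inner_direction_rpow_le (u : 𝔼 → 𝔼) (x : 𝔼) {h : 𝔼} (hh : h ≠ 0) {p : ℝ} (hp : 1 ≤ p)
    (N : ℕ) :
    |inner ℝ (u x) (‖h‖⁻¹ • h)| ^ p ≤ 2 ^ (p - 1) * (‖u (x + N • h)‖ ^ p +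
      (N : ℝ) ^ (p - 1) * ‖h‖ ^ p *
        ∑ j ∈ Finset.range N, |projDiffQuot u (x + j • h) (x + j • h + h)| ^ p) := by
  set D : ℕ → ℝ := fun j => projDiffQuot u (x + j • h) (x + j • h + h)
  have hpos : 0 < ‖h‖ := norm_pos_iff.2 hh
  have hunit : ‖‖h‖⁻¹ • h‖ = 1 := by rw [norm_smul, norm_inv, norm_norm]; field_simp
  have htel : inner ℝ (u (x + N • h)) (‖h‖⁻¹ • h) - inner ℝ (u x) (‖h‖⁻¹ • h)
      = ‖h‖ * ∑ j ∈ Finset.range N, D j := by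
    have := Finset.sum_range_sub (fun j : ℕ => inner ℝ (u (x + j • h)) (‖h‖⁻¹ • h)) N
    simp only [zero_smul, add_zero] at this
    rw [← this, Finset.mul_sum]
    refine Finset.sum_congr rfl fun j _ => ?_
    rw [← inner_sub_direction_eq u (x + j • h) hh, inner_sub_left, succ_nsmul, ← add_assoc]
  have h1 : |inner ℝ (u x) (‖h‖⁻¹ • h)| ≤ ‖u (x + N • h)‖ + ‖h‖ * ∑ j ∈ Finset.range N, |D j| := by
    have ha : inner ℝ (u x) (‖h‖⁻¹ • h) =
        inner ℝ (u (x + N • h)) (‖h‖⁻¹ • h) - ‖h‖ * ∑ j ∈ Finset.range N, D j := by linarith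
    have hb : |inner ℝ (u (x + N • h)) (‖h‖⁻¹ • h)| ≤ ‖u (x + N • h)‖ := by
      simpa only [hunit, mul_one] using
        abs_real_inner_le_norm (u (x + N • h)) (‖h‖⁻¹ • h)
    rw [ha]
    refine (abs_sub _ _).trans (add_le_add hb ?_)
    rw [abs_mul, abs_norm]
    gcongr
    exact Finset.abs_sum_le_sum_abs _ _
  have h2 := Real.rpow_sum_le_const_mul_sum_rpow (Finset.range N) D hp
  rw [Finset.card_range] at h2
  have h3 : ∀ a b : ℝ, 0 ≤ a → 0 ≤ b → (a + b) ^ p ≤ 2 ^ (p - 1) * (a ^ p + b ^ p) := by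
    intro a b ha hb
    lift a to ℝ≥0 using ha
    lift b to ℝ≥0 using hb
    exact_mod_cast NNReal.rpow_add_le_mul_rpow_add_rpow a b hp
  calc |inner ℝ (u x) (‖h‖⁻¹ • h)| ^ p
      ≤ (‖u (x + N • h)‖ + ‖h‖ * ∑ j ∈ Finset.range N, |D j|) ^ p := by gcongr
    _ ≤ 2 ^ (p - 1) * (‖u (x + N • h)‖ ^ p + (‖h‖ * ∑ j ∈ Finset.range N, |D j|) ^ p) :=
        h3 _ _ (norm_nonneg _) (by positivity)
    _ ≤ 2 ^ (p - 1) * (‖u (x + N • h)‖ ^ p + ‖h‖ ^ p *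
          ((N : ℝ) ^ (p - 1) * ∑ j ∈ Finset.range N, |D j| ^ p)) := by
        rw [Real.mul_rpow (norm_nonneg _) (by positivity)]
        gcongr
    _ = _ := by ring

/-- Translation is a measurable embedding, so no measurability of `A` or `T` is needed; `conePart`
can be used as it is. -/
theorem setLIntegral_add_right_le {E : Type*} [NormedAddCommGroup E] [MeasurableSpace E]
    [BorelSpace E] {μ : Measure E} [μ.IsAddRightInvariant] {A T : Set E}
    {s : E} (hAT : ∀ x ∈ A, x + s ∈ T) (f : E → ℝ≥0∞) :
    ∫⁻ x in A, f (x + s) ∂μ ≤ ∫⁻ x in T, f x ∂μ := by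
  calc ∫⁻ x in A, f (x + s) ∂μ ≤ ∫⁻ x in (· + s) ⁻¹' T, f (x + s) ∂μ := lintegral_mono_set hAT
    _ = ∫⁻ x in T, f x ∂μ :=
        (measurePreserving_add_right μ s).setLIntegral_comp_preimage_emb
          (measurableEmbedding_addRight s) f T

theorem measurable_projDiffQuot {u : 𝔼 → 𝔼} (hu : Measurable u) :
    Measurable fun z : 𝔼 × 𝔼 => projDiffQuot u z.1 z.2 := by
  unfold projDiffQuot
  fun_prop

/-- The energy density of the difference quotients of `u` over the step `h`, integrated over all
admissible starting points in `Ω`. -/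
noncomputable def stepEnergy (u : 𝔼 → 𝔼) (p : ℝ) (Ω : Set 𝔼) (h : 𝔼) : ℝ≥0∞ :=
  ∫⁻ x in Ω ∩ (· + h) ⁻¹' Ω, ENNReal.ofReal (|projDiffQuot u x (x + h)| ^ p)

theorem setLIntegral_conePart_le {u : 𝔼 → 𝔼} (hu : Measurable u) {p : ℝ} (hp : 1 ≤ p)
    {Ω : Set 𝔼} {w : 𝔼} {ε r : ℝ} {h : 𝔼} (hh : h ≠ 0) (hw : h ∈ sector w ε)
    (hr : ‖h‖ < r) :
    ∫⁻ x in conePart Ω w ε r, ENNReal.ofReal (|inner ℝ (u x) (‖h‖⁻¹ • h)| ^ p) ≤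
      ENNReal.ofReal (4 ^ p) * ((∫⁻ x in innerPart Ω (ε * r), ENNReal.ofReal (‖u x‖ ^ p)) +
        ENNReal.ofReal (r ^ p) * stepEnergy u p Ω h) := by
  have hpos : 0 < ‖h‖ := norm_pos_iff.2 hh
  have hr0 : 0 < r := hpos.trans hr
  -- The least number of steps reaching length `r`; as `‖h‖ < r`, it overshoots to at most `2 * r`.
  set N : ℕ := ⌈r / ‖h‖⌉₊
  have hN1 : r ≤ N * ‖h‖ := (div_le_iff₀ hpos).1 (Nat.le_ceil _)
  have hN2 : N * ‖h‖ ≤ 2 * r := by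
    have : (N : ℝ) < r / ‖h‖ + 1 := Nat.ceil_lt_add_one (by positivity)
    have := mul_lt_mul_of_pos_right this hpos
    rw [add_mul, div_mul_cancel₀ _ hpos.ne'] at this
    linarith
  have hN0 : 0 < (N : ℝ) := by by_contra hc; nlinarith
  have hnorm (j : ℕ) : ‖j • h‖ = j * ‖h‖ := by
    rw [← Nat.cast_smul_eq_nsmul ℝ, norm_smul, RCLike.norm_natCast]
  have hmem {j : ℕ} (hj : j ≤ N) {x : 𝔼} (hx : x ∈ conePart Ω w ε r) : x + j • h ∈ Ω := by
    refine (hx _ (nsmul_mem_sector hw j) ?_).1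
    rw [hnorm]
    exact le_trans (by gcongr) hN2
  have hstep : ∀ j ∈ Finset.range N, ∫⁻ x in conePart Ω w ε r,
      ENNReal.ofReal (|projDiffQuot u (x + j • h) (x + j • h + h)| ^ p) ≤ stepEnergy u p Ω h := by
    intro j hj
    refine setLIntegral_add_right_le (s := j • h) (T := Ω ∩ (· + h) ⁻¹' Ω)
      (f := fun x => ENNReal.ofReal (|projDiffQuot u x (x + h)| ^ p))
      fun x hx => ⟨?_, ?_⟩
    · exact hmem (Finset.mem_range.1 hj).le hx
    · have := hmem (Nat.succ_le_of_lt (Finset.mem_range.1 hj)) hx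
      rwa [Nat.succ_eq_add_one, succ_nsmul, ← add_assoc] at this
  have hfar : ∫⁻ x in conePart Ω w ε r, ENNReal.ofReal (‖u (x + N • h)‖ ^ p) ≤
      ∫⁻ x in innerPart Ω (ε * r), ENNReal.ofReal (‖u x‖ ^ p) :=
    setLIntegral_add_right_le (f := fun x => ENNReal.ofReal (‖u x‖ ^ p))
      fun x hx => (hx _ (nsmul_mem_sector hw N) (by rwa [hnorm])).2 (by rwa [hnorm])
  have hmeasD (j : ℕ) : Measurable fun x : 𝔼 =>
      ENNReal.ofReal (|projDiffQuot u (x + j • h) (x + j • h + h)| ^ p) := by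
    have := (measurable_projDiffQuot hu).comp
      (g := fun z : 𝔼 × 𝔼 => projDiffQuot u z.1 z.2)
      (f := fun x : 𝔼 => (x + j • h, x + j • h + h)) (by fun_prop)
    simp only [Function.comp_def] at this
    fun_prop
  calc ∫⁻ x in conePart Ω w ε r, ENNReal.ofReal (|inner ℝ (u x) (‖h‖⁻¹ • h)| ^ p)
      ≤ ∫⁻ x in conePart Ω w ε r, ENNReal.ofReal (2 ^ (p - 1)) *
          (ENNReal.ofReal (‖u (x + N • h)‖ ^ p) + ENNReal.ofReal ((N : ℝ) ^ (p - 1) * ‖h‖ ^ p) *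
            ∑ j ∈ Finset.range N,
              ENNReal.ofReal (|projDiffQuot u (x + j • h) (x + j • h + h)| ^ p)) := by
        refine lintegral_mono fun x => ?_
        rw [← ENNReal.ofReal_sum_of_nonneg fun j _ => by positivity,
          ← ENNReal.ofReal_mul (by positivity), ← ENNReal.ofReal_add (by positivity) (by positivity),
          ← ENNReal.ofReal_mul (by positivity)]
        exact ENNReal.ofReal_le_ofReal (abs_inner_direction_rpow_le u x hh hp N)
    _ = ENNReal.ofReal (2 ^ (p - 1)) *
          ((∫⁻ x in conePart Ω w ε r, ENNReal.ofReal (‖u (x + N • h)‖ ^ p)) +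
            ENNReal.ofReal ((N : ℝ) ^ (p - 1) * ‖h‖ ^ p) * ∑ j ∈ Finset.range N,
              ∫⁻ x in conePart Ω w ε r,
                ENNReal.ofReal (|projDiffQuot u (x + j • h) (x + j • h + h)| ^ p)) := by
        rw [lintegral_const_mul' _ _ ENNReal.ofReal_ne_top, lintegral_add_left (by fun_prop),
          lintegral_const_mul' _ _ ENNReal.ofReal_ne_top,
          lintegral_finsetSum _ fun j _ => hmeasD j]
    _ ≤ ENNReal.ofReal (2 ^ (p - 1)) *
          ((∫⁻ x in innerPart Ω (ε * r), ENNReal.ofReal (‖u x‖ ^ p)) +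
            ENNReal.ofReal ((N : ℝ) ^ (p - 1) * ‖h‖ ^ p) * (N * stepEnergy u p Ω h)) := by
        gcongr
        simpa using Finset.sum_le_sum hstep
    _ ≤ ENNReal.ofReal (2 ^ (p - 1)) *
          (ENNReal.ofReal (2 ^ p) * (∫⁻ x in innerPart Ω (ε * r), ENNReal.ofReal (‖u x‖ ^ p)) +
            ENNReal.ofReal (2 ^ p) * (ENNReal.ofReal (r ^ p) * stepEnergy u p Ω h)) := by
        gcongr 2
        · refine le_mul_of_one_le_left zero_le ?_
          rw [ENNReal.one_le_ofReal]
          exact Real.one_le_rpow one_le_two (by linarith)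
        · rw [← mul_assoc, ← mul_assoc, ← ENNReal.ofReal_natCast,
            ← ENNReal.ofReal_mul (by positivity), ← ENNReal.ofReal_mul (by positivity)]
          refine mul_le_mul_left (ENNReal.ofReal_le_ofReal ?_) _
          -- The power `p - 1` comes from Hölder and the last `N` from the number of steps; together
          -- they pair with `‖h‖ ^ p`, so nothing blows up as `h` tends to 0.
          calc (N : ℝ) ^ (p - 1) * ‖h‖ ^ p * N = (N * ‖h‖) ^ p := by
                rw [Real.mul_rpow hN0.le hpos.le, Real.rpow_sub_one hN0.ne']
                field_simp
            _ ≤ (2 * r) ^ p := by gcongr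
            _ = 2 ^ p * r ^ p := Real.mul_rpow zero_le_two hr0.le
    _ ≤ _ := by
        rw [← mul_add, ← mul_assoc, ← ENNReal.ofReal_mul (by positivity)]
        gcongr
        calc (2 : ℝ) ^ (p - 1) * 2 ^ p ≤ 2 ^ p * 2 ^ p := by
              gcongr
              · exact one_le_two
              · linarith
          _ = 4 ^ p := by rw [← Real.mul_rpow zero_le_two zero_le_two]; norm_num

end Telescoping

/-! ### Integration over steps -/

section Energy

variable {d : ℕ}

local notation "𝔼" => EuclideanSpace ℝ (Fin d)

/-- Tonelli and the substitution `y = x + h`. -/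
theorem lintegral_mul_stepEnergy {u : 𝔼 → 𝔼} (hu : Measurable u) (p : ℝ) {Ω : Set 𝔼}
    (hΩ : IsOpen Ω) {G : 𝔼 → ℝ≥0∞} (hG : AEMeasurable G) :
    ∫⁻ h, G h * stepEnergy u p Ω h =
      ∫⁻ x in Ω, ∫⁻ y in Ω, G (y - x) * ENNReal.ofReal (|projDiffQuot u x y| ^ p) := by
  set q : 𝔼 → 𝔼 → ℝ≥0∞ := fun x => Ω.indicator fun y => ENNReal.ofReal (|projDiffQuot u x y| ^ p)
  have hq : Measurable fun z : 𝔼 × 𝔼 => q z.1 (z.1 + z.2) := by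
    have hD := measurable_projDiffQuot hu
    have h1 : Measurable fun z : 𝔼 × 𝔼 => q z.1 z.2 :=
      (show Measurable fun z : 𝔼 × 𝔼 => ENNReal.ofReal (|projDiffQuot u z.1 z.2| ^ p) by
        fun_prop).indicator (measurable_snd hΩ.measurableSet)
    exact h1.comp (f := fun z : 𝔼 × 𝔼 => (z.1, z.1 + z.2)) (by fun_prop)
  have hstep (h : 𝔼) : G h * stepEnergy u p Ω h = ∫⁻ x in Ω, G h * q x (x + h) := by
    have hqh : Measurable fun x => q x (x + h) :=
      hq.comp (f := fun x : 𝔼 => (x, h)) (by fun_prop)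
    rw [lintegral_const_mul _ hqh, stepEnergy,
      Set.inter_comm, ← setLIntegral_indicator (measurable_add_const h hΩ.measurableSet)]
    rfl
  simp_rw [hstep]
  rw [lintegral_lintegral_swap]
  · refine lintegral_congr fun x => ?_
    rw [← lintegral_sub_right_eq_self _ x, ← lintegral_indicator hΩ.measurableSet]
    refine lintegral_congr fun y => ?_
    by_cases hy : y ∈ Ω <;> simp [q, hy]
  · exact hG.comp_fst.mul (hq.comp measurable_swap).aemeasurable

theorem exists_setLIntegral_conePart_mul_le [Nontrivial 𝔼] {p : ℝ} (hp : 1 ≤ p) {ε : ℝ}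
    (hε : 0 < ε) (hε1 : ε ≤ 1) :
    ∃ C : ℝ, 0 < C ∧ ∀ w : 𝔼, ‖w‖ = 1 → ∀ (r : ℝ) (G : 𝔼 → ℝ≥0∞), AEMeasurable G →
      (∀ h k, ‖h‖ = ‖k‖ → G h = G k) → ∀ Ω : Set 𝔼, IsOpen Ω → ∀ u : 𝔼 → 𝔼, Measurable u →
      (∫⁻ x in conePart Ω w ε r, ENNReal.ofReal (‖u x‖ ^ p)) * (∫⁻ h in ball 0 r, G h) ≤
        ENNReal.ofReal C *
          ((∫⁻ x in innerPart Ω (ε * r), ENNReal.ofReal (‖u x‖ ^ p)) * (∫⁻ h in ball 0 r, G h) +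
            ENNReal.ofReal (r ^ p) * ∫⁻ x in Ω, ∫⁻ y in Ω,
              G (y - x) * ENNReal.ofReal (|projDiffQuot u x y| ^ p)) := by
  obtain ⟨C, hC, hcoer⟩ := exists_norm_rpow_mul_setLIntegral_le (E := 𝔼)
    (zero_le_one.trans hp) hε hε1
  refine ⟨C * 4 ^ p, by positivity, fun w hw r G hG hrad Ω hΩ u hu => ?_⟩
  set K := sector w ε ∩ ball (0 : 𝔼) r
  have hKm : MeasurableSet K := (isClosed_sector _ _).measurableSet.inter measurableSet_ball
  set I := ∫⁻ x in innerPart Ω (ε * r), ENNReal.ofReal (‖u x‖ ^ p)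
  calc (∫⁻ x in conePart Ω w ε r, ENNReal.ofReal (‖u x‖ ^ p)) * (∫⁻ h in ball 0 r, G h)
      = ∫⁻ x in conePart Ω w ε r, ENNReal.ofReal (‖u x‖ ^ p) * ∫⁻ h in ball 0 r, G h :=
        (lintegral_mul_const _ (by fun_prop)).symm
    _ ≤ ∫⁻ x in conePart Ω w ε r, ENNReal.ofReal C * ∫⁻ h in K,
          G h * ENNReal.ofReal (|inner ℝ (u x) (‖h‖⁻¹ • h)| ^ p) :=
        lintegral_mono fun x => hcoer w hw r G hrad (u x)
    _ = ENNReal.ofReal C * ∫⁻ h in K, ∫⁻ x in conePart Ω w ε r,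
          G h * ENNReal.ofReal (|inner ℝ (u x) (‖h‖⁻¹ • h)| ^ p) := by
        rw [lintegral_const_mul' _ _ ENNReal.ofReal_ne_top, lintegral_lintegral_swap]
        exact hG.restrict.comp_snd.mul (by fun_prop)
    _ ≤ ENNReal.ofReal C * ∫⁻ h in K, G h * (ENNReal.ofReal (4 ^ p) *
          (I + ENNReal.ofReal (r ^ p) * stepEnergy u p Ω h)) := by
        gcongr 1
        refine lintegral_mono_ae ?_
        filter_upwards [ae_restrict_mem hKm, ae_restrict_of_ae (volume.ae_ne (0 : 𝔼))]
          with h hh h0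
        rw [lintegral_const_mul _ (by fun_prop)]
        gcongr
        exact setLIntegral_conePart_le hu hp h0 hh.1 (by simpa using hh.2)
    _ = ENNReal.ofReal C * (ENNReal.ofReal (4 ^ p) * ((∫⁻ h in K, G h) * I +
          ENNReal.ofReal (r ^ p) * ∫⁻ h in K, G h * stepEnergy u p Ω h)) := by
        simp_rw [mul_left_comm (G _)]
        rw [lintegral_const_mul' _ _ ENNReal.ofReal_ne_top]
        simp_rw [mul_add (G _), mul_left_comm (G _)]
        rw [lintegral_add_left' (hG.restrict.mul_const I), lintegral_mul_const'' _ hG.restrict,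
          lintegral_const_mul' _ _ ENNReal.ofReal_ne_top]
    -- The cone is enlarged to the ball in the mass term and to the whole space in the energy term.
    _ ≤ ENNReal.ofReal C * (ENNReal.ofReal (4 ^ p) * ((∫⁻ h in ball 0 r, G h) * I +
          ENNReal.ofReal (r ^ p) * ∫⁻ h, G h * stepEnergy u p Ω h)) := by
        gcongr
        · exact Set.inter_subset_right
        · exact Measure.restrict_le_self
    _ = _ := by
        rw [lintegral_mul_stepEnergy hu p hΩ hG, ENNReal.ofReal_mul hC.le, mul_comm I, mul_assoc]

theorem nonlocalSeminormPow_eq {ρ : 𝔼 → ℝ} (hρ : ∀ h, 0 ≤ ρ h) (p : ℝ) (Ω : Set 𝔼) (u : 𝔼 → 𝔼) :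
    nonlocalSeminormPow ρ p Ω u = ∫⁻ x in Ω, ∫⁻ y in Ω,
      ENNReal.ofReal (ρ (y - x)) * ENNReal.ofReal (|projDiffQuot u x y| ^ p) := by
  simp only [nonlocalSeminormPow, ENNReal.ofReal_mul (hρ _)]

theorem nonlocalSeminormPow_congr_ae (ρ : 𝔼 → ℝ) (p : ℝ) {Ω : Set 𝔼} {u v : 𝔼 → 𝔼}
    (h : u =ᵐ[volume.restrict Ω] v) : nonlocalSeminormPow ρ p Ω u = nonlocalSeminormPow ρ p Ω v := by
  refine lintegral_congr_ae ?_
  filter_upwards [h] with x hx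
  refine lintegral_congr_ae ?_
  filter_upwards [h] with y hy
  simp only [projDiffQuot, hx, hy]

end Energy

/-! ### Assembly over the finite net of cones -/

theorem lemma3p3 (d : ℕ) (hd : 1 ≤ d) (p : ℝ) (hp : 1 ≤ p) (κ : ℝ≥0) :
    ∃ C₂ ε₀ : ℝ, 0 < C₂ ∧ 0 < ε₀ ∧ ε₀ < 1 ∧
      ∀ R : ℝ, 0 < R → ∃ r₀ : ℝ, 0 < r₀ ∧
        ∀ Ω : Set (EuclideanSpace ℝ (Fin d)), IsLipschitzDomain κ R Ω →
          ∃ C₁ : ℝ → ℝ, ∀ r : ℝ, 0 < r → r < r₀ → 0 < C₁ r ∧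
            ∀ u : EuclideanSpace ℝ (Fin d) → EuclideanSpace ℝ (Fin d),
              MemLp u (ENNReal.ofReal p) (volume.restrict Ω) →
            ∀ ρ : EuclideanSpace ℝ (Fin d) → ℝ,
              LocallyIntegrable ρ volume →
              (∀ h, 0 ≤ ρ h) →
              (∀ h k, ‖h‖ = ‖k‖ → ρ h = ρ k) →
              0 < (∫ h in ball (0 : EuclideanSpace ℝ (Fin d)) r, ρ h) →
              (∫⁻ x in Ω, ENNReal.ofReal (‖u x‖ ^ p)) ≤
                ENNReal.ofReal (C₁ r) *
                    (∫⁻ x in innerPart Ω (ε₀ * r), ENNReal.ofReal (‖u x‖ ^ p)) +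
                  ENNReal.ofReal
                      (C₂ * r ^ p / (∫ h in ball (0 : EuclideanSpace ℝ (Fin d)) r, ρ h)) *
                    nonlocalSeminormPow ρ p Ω u := by
  have : Nonempty (Fin d) := ⟨⟨0, hd⟩⟩
  have hκ : 0 ≤ (κ : ℝ) := κ.coe_nonneg
  set ε : ℝ := 1 / (4 * (1 + κ)) with hε
  have hε0 : 0 < ε := by positivity
  have hε1 : ε < 1 := by rw [hε, div_lt_one (by positivity)]; linarith
  obtain ⟨t, ht, hnet⟩ := exists_finset_net_sphere (E := EuclideanSpace ℝ (Fin d)) hε0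
  obtain ⟨C, hC, hcone⟩ := exists_setLIntegral_conePart_mul_le (d := d) hp hε0 hε1.le
  refine ⟨(t.card + 1) * C, ε, by positivity, hε0, hε1, fun R hR => ⟨R / 8, by positivity,
    fun Ω hΩ => ⟨fun _ => 1 + (t.card + 1) * C, fun r hr hrR => ⟨by positivity, ?_⟩⟩⟩⟩
  intro u hu ρ hρ hρ0 hrad hpos
  obtain ⟨v, hv, huv⟩ : ∃ v, Measurable v ∧ u =ᵐ[volume.restrict Ω] v :=
    hu.aestronglyMeasurable.aemeasurable
  have hcongr {S : Set (EuclideanSpace ℝ (Fin d))} (hS : S ⊆ Ω) :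
      ∫⁻ x in S, ENNReal.ofReal (‖u x‖ ^ p) = ∫⁻ x in S, ENNReal.ofReal (‖v x‖ ^ p) := by
    refine lintegral_congr_ae ?_
    filter_upwards [ae_restrict_of_ae_restrict_of_subset hS huv] with x hx
    rw [hx]
  rw [hcongr subset_rfl, hcongr fun x hx => hx.1, nonlocalSeminormPow_congr_ae ρ p huv]
  set I := ∫⁻ x in innerPart Ω (ε * r), ENNReal.ofReal (‖v x‖ ^ p)
  set S := nonlocalSeminormPow ρ p Ω v
  set m := ∫ h in ball (0 : EuclideanSpace ℝ (Fin d)) r, ρ h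
  have hint : IntegrableOn ρ (ball 0 r) :=
    (hρ.integrableOn_isCompact (isCompact_closedBall 0 r)).mono_set ball_subset_closedBall
  have hmG : ∫⁻ h in ball 0 r, ENNReal.ofReal (ρ h) = ENNReal.ofReal m :=
    (ofReal_integral_eq_lintegral_ofReal hint (.of_forall hρ0)).symm
  have hm0 : ENNReal.ofReal m ≠ 0 := by simpa using hpos
  have hw : ∀ w ∈ t, ∫⁻ x in conePart Ω w ε r, ENNReal.ofReal (‖v x‖ ^ p) ≤
      ENNReal.ofReal C * (I + ENNReal.ofReal (r ^ p / m) * S) := by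
    intro w hwt
    have h := hcone w (ht w hwt) r (fun h => ENNReal.ofReal (ρ h))
      hρ.aestronglyMeasurable.aemeasurable.ennreal_ofReal
      (fun h k hhk => by rw [hrad h k hhk]) Ω hΩ.isOpen v hv
    rw [← nonlocalSeminormPow_eq hρ0, hmG] at h
    -- Cancel the mass `m`, which is positive and finite.
    refine (ENNReal.mul_le_mul_iff_left hm0 ENNReal.ofReal_ne_top).1 (h.trans_eq ?_)
    rw [mul_assoc, add_mul, mul_right_comm, ← ENNReal.ofReal_mul (by positivity),
      div_mul_cancel₀ _ hpos.ne']
  have hcover : Ω ⊆ innerPart Ω (ε * r) ∪ ⋃ w : t, conePart Ω (w : _) ε r := by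
    intro x hx
    by_cases hxi : x ∈ innerPart Ω (ε * r)
    · exact .inl hxi
    · obtain ⟨w, hwt, hxw⟩ := hΩ.exists_mem_conePart hr hrR hnet hx hxi
      exact .inr (Set.mem_iUnion.2 ⟨⟨w, hwt⟩, hxw⟩)
  calc ∫⁻ x in Ω, ENNReal.ofReal (‖v x‖ ^ p)
      ≤ I + ∑' w : t, ∫⁻ x in conePart Ω (w : _) ε r, ENNReal.ofReal (‖v x‖ ^ p) :=
        (lintegral_mono_set hcover).trans <| (lintegral_union_le _ _ _).trans <|
          add_le_add_right (lintegral_iUnion_le _ _) _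
    _ ≤ I + ∑ w : t, ENNReal.ofReal C * (I + ENNReal.ofReal (r ^ p / m) * S) := by
        rw [tsum_fintype]
        gcongr with w
        exact hw w w.2
    _ = I + ENNReal.ofReal (t.card * C) * (I + ENNReal.ofReal (r ^ p / m) * S) := by
        rw [ENNReal.ofReal_mul (by positivity), ENNReal.ofReal_natCast, mul_assoc]
        simp
    _ ≤ I + ENNReal.ofReal ((t.card + 1) * C) * (I + ENNReal.ofReal (r ^ p / m) * S) := by
        gcongr; linarith
    _ = _ := by
        have hD : 0 ≤ (t.card + 1) * C := by positivity
        rw [mul_div_assoc, ENNReal.ofReal_add zero_le_one hD, ENNReal.ofReal_mul hD,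
          ENNReal.ofReal_one]
        ring
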